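/- Let $N\in\mathbb N$ and let $G(\mathbb R)=(\mathbb R^N,\circ,\delta_{\lambda^\sigma})$ be a real homogeneous Lie group of integer weight. That is, $\circ$ is a group law on $\mathbb R^N$ which makes $\mathbb R^N$ (with its standard smooth structure) a Lie group, $\sigma=(\sigma_1,\dots,\sigma_N)$ are integers with $1\le\sigma_1\le\dots\le\sigma_N$, and for every real $\lambda\neq 0$ the scaling operator $\delta_{\lambda^\sigma}(x_1,\dots,x_N)=(\lambda^{\sigma_1}x_1,\dots,\lambda^{\sigma_N}x_N)$ is an automorphism of $(\mathbb R^N,\circ)$. Then there are finitely many real numbers $\alpha_1,\dots,\alpha_n$ and, over the field $k:=\mathbb Q(\alpha_1,\dots,\alpha_n)\subseteq\mathbb R$, polynomials $Q_1,\dots,Q_N\in k[X_1,\dots,X_N,Y_1,\dots,Y_N]$ with the following properties. 1. For all $x,y\in\mathbb R^N$ and all $j$ one has $(x\circ y)_j=x_j+y_j+Q_j(x,y)$, and each $\alpha_i$ is a coefficient of some $Q_j$. The polynomial $Q_j$ is homogeneous of degree $\sigma_j$ when $X_i$ and $Y_i$ have degree $\sigma_i$; each of its monomials contains at least one of the $X$-variables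 and at least one of the $Y$-variables; and only variables $X_i,Y_i$ with $i<j$ and $\sigma_i<\sigma_j$ occur in it. 2. The $k$-algebra $A=k[X_1,\dots,X_N]$ carries a Hopf algebra structure with co-product $$\Delta(X_j)=X_j\otimes 1+1\otimes X_j+Q_j(X_1\otimes 1,\dots,X_N\otimes 1,\,1\otimes X_1,\dots,1\otimes X_N),\qquad 1\le j\le N.$$ With the grading $A=\bigoplus_{m\ge 0}A_m$, where $A_m$ is spanned over $k$ by the monomials $X^\beta$ with $\beta_1\sigma_1+\dots+\beta_N\sigma_N=m$, it is a graded connected Hopf algebra: $A_0=k\cdot 1$, and product, unit, co-product, co-unit and antipode are homogeneous of degree $0$. 3. $G(\mathbb R)$ is the group of real points of the affine group scheme $\operatorname{Spec}A$ over $k$: there is an isomorphism of groups $\operatorname{Spec}(A)(\mathbb R)\cong(\mathbb R^N,\circ)$ which sends the point given by a $k$-algebra homomorphism $f:A\to\mathbb R$ to $(f(X_1),\dots,f(X_N))$. 4. The group scheme $\operatorname{Spec}A$ over $k$ is smooth and unipotent, i.e. every nonzero representation of it (every nonzero $A$-comodule) contains a nonzero fixed vector. -/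

import Mathlib

open scoped TensorProduct Manifold ContDiff
open AlgebraicGeometry CategoryTheory MonObj

universe u

noncomputable section

/-- The scaling operator `δ_{t^σ}` on `ℝ^N`: `(x_1, …, x_N) ↦ (t^{σ_1} x_1, …, t^{σ_N} x_N)`. -/
def scaling {N : ℕ} (σ : Fin N → ℕ) (t : ℝ) (x : EuclideanSpace ℝ (Fin N)) :
    EuclideanSpace ℝ (Fin N) :=
  WithLp.toLp 2 fun j => t ^ σ j * x j

/-- A real homogeneous Lie group `(ℝ^N, ∘, δ_{t^σ})` of integer weight. The manifold `ℝ^N` with its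
standard smooth structure carries a smooth group law `∘` (written `*`), the weights are
integers `1 ≤ σ_1 ≤ … ≤ σ_N`, and every scaling operator with `t ≠ 0` is multiplicative
(it is bijective anyway, hence an automorphism). -/
structure IsHomogeneousLieGroup {N : ℕ} (σ : Fin N → ℕ) [Group (EuclideanSpace ℝ (Fin N))] :
    Prop where
  lieGroup : LieGroup (𝓡 N) ∞ (EuclideanSpace ℝ (Fin N))
  one_le : ∀ j, 1 ≤ σ j
  monotone : Monotone σ
  scaling_mul : ∀ t : ℝ, t ≠ 0 → ∀ x y : EuclideanSpace ℝ (Fin N),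
    scaling σ t (x * y) = scaling σ t x * scaling σ t y

/-- The subfield `ℚ(α_1, …, α_n)` of `ℝ`. -/
abbrev ratAdjoin {n : ℕ} (α : Fin n → ℝ) : IntermediateField ℚ ℝ :=
  IntermediateField.adjoin ℚ (Set.range α)

/-- `𝒜` is a grading of the Hopf algebra `A` over `k` by the natural numbers which makes it a
connected graded Hopf algebra: all structure maps are homogeneous of degree `0`
and `A_0 = k · 1`. -/
structure IsGradedConnectedHopfAlgebra (k A : Type*) [Field k] [CommRing A] [HopfAlgebra k A]
    (𝒜 : ℕ → Submodule k A) : Prop where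
  isInternal : DirectSum.IsInternal 𝒜
  one_mem : (1 : A) ∈ 𝒜 0
  mul_mem : ∀ {m n : ℕ} {a b : A}, a ∈ 𝒜 m → b ∈ 𝒜 n → a * b ∈ 𝒜 (m + n)
  comul_mem : ∀ {n : ℕ} {a : A}, a ∈ 𝒜 n → Coalgebra.comul (R := k) a ∈
    ⨆ p ∈ Finset.HasAntidiagonal.antidiagonal n,
      LinearMap.range (TensorProduct.map (𝒜 p.1).subtype (𝒜 p.2).subtype)
  counit_eq_zero : ∀ {n : ℕ} {a : A}, a ∈ 𝒜 n → n ≠ 0 → Coalgebra.counit (R := k) a = 0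
  antipode_mem : ∀ {n : ℕ} {a : A}, a ∈ 𝒜 n → HopfAlgebra.antipode k a ∈ 𝒜 n
  connected : 𝒜 0 = Submodule.span k {(1 : A)}

/-- A (linear) representation on the `k`-vector space `V` of the affine group scheme `Spec A`,
i.e. a right comodule over the Hopf algebra `A`. -/
structure GroupSchemeRep (k A V : Type*) [Field k] [CommRing A] [HopfAlgebra k A]
    [AddCommGroup V] [Module k V] where
  coact : V →ₗ[k] V ⊗[k] A
  coassoc : (TensorProduct.assoc k V A A).toLinearMap ∘ₗ coact.rTensor A ∘ₗ coact =
    (Coalgebra.comul (R := k) (A := A)).lTensor V ∘ₗ coact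
  counit_coact : (TensorProduct.rid k V).toLinearMap ∘ₗ
    (Coalgebra.counit (R := k) (A := A)).lTensor V ∘ₗ coact = LinearMap.id

/-- The affine group scheme `Spec A` over the field `k` is unipotent: every nonzero representation
has a nonzero fixed vector. -/
def IsUnipotentGroupScheme.{w₁, w₂, w} (k : Type w₁) (A : Type w₂) [Field k] [CommRing A]
    [HopfAlgebra k A] : Prop :=
  ∀ (V : Type w) [AddCommGroup V] [Module k V] [Nontrivial V] (r : GroupSchemeRep k A V),
    ∃ v : V, v ≠ 0 ∧ r.coact v = v ⊗ₜ[k] (1 : A)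

/-- The conditions on the correction terms `Q_j` of a group law `x_j + y_j + Q_j(x, y)` that is
homogeneous of weight `σ`. The variables `X_i` and `Y_i` are `Sum.inl i` and `Sum.inr i`.
The polynomial `Q_j` is homogeneous of degree `σ_j`, each of its monomials contains both an
`X`-variable and a `Y`-variable, and only variables `X_i, Y_i` with `i < j` and
`σ_i < σ_j` occur. -/
structure IsCorrectionTerm {N : ℕ} (σ : Fin N → ℕ) {k : Type*} [Field k] (j : Fin N)
    (q : MvPolynomial (Fin N ⊕ Fin N) k) : Prop where
  homogeneous : q.IsWeightedHomogeneous (Sum.elim σ σ) (σ j)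
  mixed : ∀ d ∈ q.support, (∃ i, d (Sum.inl i) ≠ 0) ∧ (∃ i, d (Sum.inr i) ≠ 0)
  lower : ∀ i, Sum.inl i ∈ q.vars ∨ Sum.inr i ∈ q.vars → i < j ∧ σ i < σ j

end

/-! The group law is smooth, and its `j`-th coordinate scales by `t ^ σ j` under the dilations. A
smooth function with this property for positive weights is a polynomial. By induction on the degree,
its partial derivatives are homogeneous of smaller degree, hence polynomials, and Euler's identity
recovers the function from them (`exists_polynomial_of_homogeneous`). The dilations fix the unit, so
it is `0`. Thus `(x ∘ y)_j - x_j - y_j` vanishes for `x = 0` and for `y = 0`, so each of its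
monomials is mixed. Homogeneity then bounds the weights of the variables
(`IsCorrectionTerm.of_homogeneous_of_mixed`), and this triangular shape lets the inverse be solved
for recursively as a polynomial map.

Finitely many coefficients occur, and they generate `k`. The group axioms hold at real points, so
they are polynomial identities over `k` and hold over every `k`-algebra
(`IsPolyGroupLaw.of_points`). Evaluated at universal points they are the Hopf algebra axioms for
`k[X]`; real points with convolution product give back the group.

Unipotence uses only the connected grading. Expand the coaction of a nonzero vector in a homogeneous
basis of `A`. A nonzero coefficient at a basis element of maximal degree is fixed, because
contracting the coproduct against the corresponding coordinate leaves only the degree zero part,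
`A_0 = k`, in the other factor. -/

noncomputable section

/-! ### Connected graded Hopf algebras and fixed vectors -/

section Unipotent

variable {k A : Type*} [Field k] [CommRing A] [HopfAlgebra k A] {𝒜 : ℕ → Submodule k A}

/-- Contracting the right tensor factor of the coproduct against a functional that lives in
degree `n` maps elements of degree at most `n` to constants. -/
theorem IsGradedConnectedHopfAlgebra.rid_lTensor_comul_mem_span_one
    (h : IsGradedConnectedHopfAlgebra k A 𝒜) {c : A →ₗ[k] k} {m n : ℕ} (hmn : m ≤ n)
    (hc : ∀ q ≠ n, ∀ a ∈ 𝒜 q, c a = 0) {a : A} (ha : a ∈ 𝒜 m) :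
    TensorProduct.rid k A (c.lTensor A (Coalgebra.comul (R := k) a)) ∈
      Submodule.span k {(1 : A)} := by
  have key : (⨆ p ∈ Finset.HasAntidiagonal.antidiagonal m,
      LinearMap.range (TensorProduct.map (𝒜 p.1).subtype (𝒜 p.2).subtype)) ≤
      (Submodule.span k {(1 : A)}).comap
        ((TensorProduct.rid k A).toLinearMap ∘ₗ c.lTensor A) := by
    refine iSup₂_le fun p hp => ?_
    rintro _ ⟨t, rfl⟩
    rw [Submodule.mem_comap]
    induction t with
    | zero => simp
    | add s t hs ht => rw [map_add, map_add]; exact Submodule.add_mem _ hs ht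
    | tmul x y =>
      have hp' := Finset.HasAntidiagonal.mem_antidiagonal.1 hp
      have hval : ((TensorProduct.rid k A).toLinearMap ∘ₗ c.lTensor A)
          (TensorProduct.map (𝒜 p.1).subtype (𝒜 p.2).subtype (x ⊗ₜ y)) =
          c (y : A) • (x : A) := by simp
      rw [hval]
      -- Since `p.1 + p.2 = m ≤ n`, a right factor of degree `n` leaves degree `0` on the left,
      -- where connectedness applies.
      by_cases hq : p.2 = n
      · have hp1 : p.1 = 0 := by omega
        have hx : (x : A) ∈ 𝒜 0 := hp1 ▸ x.2
        rw [h.connected] at hx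
        exact Submodule.smul_mem _ _ hx
      · simp [hc _ hq _ y.2]
  exact key (h.comul_mem ha)

/-- The contraction is already known to be a constant; applying the counit to it identifies the
constant, since `(ε ⊗ c) ∘ Δ = c`. -/
theorem IsGradedConnectedHopfAlgebra.rid_lTensor_comul
    (h : IsGradedConnectedHopfAlgebra k A 𝒜) {c : A →ₗ[k] k} {m n : ℕ} (hmn : m ≤ n)
    (hc : ∀ q ≠ n, ∀ a ∈ 𝒜 q, c a = 0) {a : A} (ha : a ∈ 𝒜 m) :
    TensorProduct.rid k A (c.lTensor A (Coalgebra.comul (R := k) a)) = c a • 1 := by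
  obtain ⟨r, hr⟩ := Submodule.mem_span_singleton.1 (h.rid_lTensor_comul_mem_span_one hmn hc ha)
  have hcounit : Coalgebra.counit (R := k)
      (TensorProduct.rid k A (c.lTensor A (Coalgebra.comul (R := k) a))) = c a := by
    have hswap : (Coalgebra.counit (R := k) (A := A)) ∘ₗ (TensorProduct.rid k A).toLinearMap ∘ₗ
        c.lTensor A = c ∘ₗ (TensorProduct.lid k A).toLinearMap ∘ₗ
        (Coalgebra.counit (R := k) (A := A)).rTensor A := by
      ext x y
      simp [mul_comm]
    have := LinearMap.congr_fun hswap (Coalgebra.comul (R := k) a)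
    simpa using this
  rw [← hr] at hcounit ⊢
  have : r = c a := by simpa using hcounit
  rw [this]

/-- The affine group scheme of a connected graded Hopf algebra is unipotent. -/
theorem IsGradedConnectedHopfAlgebra.isUnipotentGroupScheme
    (h : IsGradedConnectedHopfAlgebra k A 𝒜) : IsUnipotentGroupScheme k A := by
  classical
  intro V _ _ _ r
  let b := h.isInternal.collectedBasis fun i => Module.Free.chooseBasis k (𝒜 i)
  obtain ⟨v, hv⟩ := exists_ne (0 : V)
  let f := TensorProduct.equivFinsuppOfBasisRight b (r.coact v)
  have hρ : r.coact v = f.sum fun i m => m ⊗ₜ b i := by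
    rw [← TensorProduct.equivFinsuppOfBasisRight_symm_apply, LinearEquiv.symm_apply_apply]
  have hf : f ≠ 0 := by
    intro hf
    have h0 : r.coact v = 0 := by rw [hρ, hf, Finsupp.sum_zero_index]
    have := LinearMap.congr_fun r.counit_coact v
    simp only [LinearMap.comp_apply, h0, map_zero, LinearMap.id_apply] at this
    exact hv this.symm
  -- The fixed vector is the coefficient `f s` at a basis element of maximal degree in the expansion
  -- of `r.coact v`.
  obtain ⟨s, hs, hmax⟩ := f.support.exists_max_image Sigma.fst
    (Finsupp.support_nonempty_iff.2 hf)
  have hfs : f s = TensorProduct.rid k V ((b.coord s).lTensor V (r.coact v)) :=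
    TensorProduct.equivFinsuppOfBasisRight_apply b _ _
  have hc : ∀ q ≠ s.1, ∀ a ∈ 𝒜 q, b.coord s a = 0 := fun q hq a ha => by
    obtain ⟨s₁, s₂⟩ := s
    exact h.isInternal.collectedBasis_repr_of_mem_ne _ hq ha
  refine ⟨f s, Finsupp.mem_support_iff.1 hs, ?_⟩
  -- Together with coassociativity this gives `ρ(f s) = (id ⊗ (id ⊗ c) Δ) ρ(v)` with `c = b.coord
  -- s`, so only the contracted coproducts of basis elements are needed.
  have hcontract : r.coact ∘ₗ (TensorProduct.rid k V).toLinearMap ∘ₗ (b.coord s).lTensor V =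
      ((TensorProduct.rid k A).toLinearMap ∘ₗ (b.coord s).lTensor A).lTensor V ∘ₗ
        (TensorProduct.assoc k V A A).toLinearMap ∘ₗ r.coact.rTensor A := by
    have aux : ∀ (t : V ⊗[k] A) (a : A), (b.coord s a) • t =
        (((TensorProduct.rid k A).toLinearMap ∘ₗ (b.coord s).lTensor A).lTensor V)
          (TensorProduct.assoc k V A A (t ⊗ₜ a)) := by
      intro t a
      induction t with
      | zero => simp
      | add x y hx hy => rw [smul_add, hx, hy, TensorProduct.add_tmul, map_add, map_add]
      | tmul x y => simp
    ext x a
    simpa using aux (r.coact x) a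
  have h1 := LinearMap.congr_fun hcontract (r.coact v)
  have h2 := LinearMap.congr_fun r.coassoc v
  simp only [LinearMap.comp_apply, LinearEquiv.coe_coe] at h1 h2
  rw [hfs, h1, h2, hρ, Finsupp.sum, map_sum, map_sum, map_sum, map_sum, TensorProduct.sum_tmul]
  refine Finset.sum_congr rfl fun i hi => ?_
  have hθ := h.rid_lTensor_comul (hmax i hi) hc
    (h.isInternal.collectedBasis_mem (fun i => Module.Free.chooseBasis k (𝒜 i)) i)
  simp only [LinearMap.lTensor_tmul, LinearMap.comp_apply, LinearEquiv.coe_coe,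
    TensorProduct.rid_tmul]
  rw [hθ, TensorProduct.tmul_smul, TensorProduct.smul_tmul']

end Unipotent

/-! ### Polynomial group laws and their dual Hopf algebras -/

section PolynomialGroupLaw

open MvPolynomial

variable {J k : Type*} [Field k]

/-- The operation on the `B`-points of affine space given by polynomials `P` in two sets of
variables. -/
def polyOp {B : Type*} [CommRing B] [Algebra k B] (P : J → MvPolynomial (J ⊕ J) k)
    (x y : J → B) : J → B :=
  fun j => aeval (Sum.elim x y) (P j)

/-- The map on the `B`-points of affine space given by polynomials `S`. -/
def polyMap {B : Type*} [CommRing B] [Algebra k B] (S : J → MvPolynomial J k) (x : J → B) :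
    J → B :=
  fun j => aeval x (S j)

theorem map_polyOp {B C : Type*} [CommRing B] [Algebra k B] [CommRing C] [Algebra k C]
    (φ : B →ₐ[k] C) (P : J → MvPolynomial (J ⊕ J) k) (x y : J → B) :
    φ ∘ polyOp P x y = polyOp P (φ ∘ x) (φ ∘ y) := by
  funext j
  have : (φ.comp (aeval (Sum.elim x y))) = aeval (Sum.elim (φ ∘ x) (φ ∘ y)) := by
    ext i; rcases i with i | i <;> simp
  simp [polyOp, ← this]

theorem map_polyMap {B C : Type*} [CommRing B] [Algebra k B] [CommRing C] [Algebra k C]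
    (φ : B →ₐ[k] C) (S : J → MvPolynomial J k) (x : J → B) :
    φ ∘ polyMap S x = polyMap S (φ ∘ x) := by
  funext j
  have : (φ.comp (aeval x)) = aeval (φ ∘ x) := by ext i; simp
  simp [polyMap, ← this]

/-- The polynomials `P` and `S` define a group law with unit `0` and inversion `S` on the `B`-points
of affine space for all commutative algebras `B`. -/
structure IsPolyGroupLaw.{v, w, b} {J : Type v} {k : Type w} [Field k]
    (P : J → MvPolynomial (J ⊕ J) k) (S : J → MvPolynomial J k) : Prop where
  assoc : ∀ (B : Type b) [CommRing B] [Algebra k B] (x y z : J → B),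
    polyOp P (polyOp P x y) z = polyOp P x (polyOp P y z)
  zero_op : ∀ (B : Type b) [CommRing B] [Algebra k B] (x : J → B), polyOp P 0 x = x
  op_zero : ∀ (B : Type b) [CommRing B] [Algebra k B] (x : J → B), polyOp P x 0 = x
  inv_op : ∀ (B : Type b) [CommRing B] [Algebra k B] (x : J → B), polyOp P (polyMap S x) x = 0
  op_inv : ∀ (B : Type b) [CommRing B] [Algebra k B] (x : J → B), polyOp P x (polyMap S x) = 0

theorem eq_of_forall_aeval_eq {τ K : Type*} [Field K] [Infinite K] [Algebra k K]
    {p q : MvPolynomial τ k} (h : ∀ x : τ → K, aeval x p = aeval x q) : p = q := by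
  apply map_injective (algebraMap k K) (algebraMap k K).injective
  apply MvPolynomial.funext
  intro x
  simpa [eval_map, aeval_def] using h x

theorem comp_zero_fun {B C : Type*} [CommRing B] [Algebra k B] [CommRing C] [Algebra k C]
    (φ : B →ₐ[k] C) : φ ∘ (0 : J → B) = 0 := by
  ext; simp

theorem comp_aeval_X {B : Type*} [CommRing B] [Algebra k B] (x : J → B) :
    (aeval x : _ →ₐ[k] B) ∘ (X : J → MvPolynomial J k) = x := by
  ext; simp

/-- A polynomial group law over an infinite extension field is a polynomial group law. -/
theorem IsPolyGroupLaw.of_points (K : Type*) [Field K] [Infinite K] [Algebra k K]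
    {P : J → MvPolynomial (J ⊕ J) k} {S : J → MvPolynomial J k}
    (assoc : ∀ x y z : J → K, polyOp P (polyOp P x y) z = polyOp P x (polyOp P y z))
    (zero_op : ∀ x : J → K, polyOp P 0 x = x) (op_zero : ∀ x : J → K, polyOp P x 0 = x)
    (inv_op : ∀ x : J → K, polyOp P (polyMap S x) x = 0)
    (op_inv : ∀ x : J → K, polyOp P x (polyMap S x) = 0) : IsPolyGroupLaw P S := by
  -- Each axiom is proved for tuples of variables, where `K`-points detect equality, and then
  -- specialised to `B` by evaluation.
  have generic : ∀ {τ : Type _} (u v : J → MvPolynomial τ k),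
      (∀ x : τ → K, (aeval x : _ →ₐ[k] K) ∘ u = (aeval x : _ →ₐ[k] K) ∘ v) → u = v :=
    fun u v h => _root_.funext fun j => eq_of_forall_aeval_eq fun x => congrFun (h x) j
  refine ⟨fun B _ _ x y z => ?_, fun B _ _ x => ?_, fun B _ _ x => ?_, fun B _ _ x => ?_,
    fun B _ _ x => ?_⟩
  · have := generic (τ := J ⊕ J ⊕ J)
      (polyOp P (polyOp P (fun i => X (.inl i)) (fun i => X (.inr (.inl i))))
        (fun i => X (.inr (.inr i))))
      (polyOp P (fun i => X (.inl i)) (polyOp P (fun i => X (.inr (.inl i)))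
        (fun i => X (.inr (.inr i))))) fun x => by simp only [map_polyOp, assoc]
    have := congrArg (fun u => (aeval (Sum.elim x (Sum.elim y z)) : _ →ₐ[k] B) ∘ u) this
    have h1 : (aeval (Sum.elim x (Sum.elim y z)) : _ →ₐ[k] B) ∘ (fun i => X (.inl i)) = x := by
      ext; simp
    have h2 : (aeval (Sum.elim x (Sum.elim y z)) : _ →ₐ[k] B) ∘ (fun i => X (.inr (.inl i))) =
        y := by ext; simp
    have h3 : (aeval (Sum.elim x (Sum.elim y z)) : _ →ₐ[k] B) ∘ (fun i => X (.inr (.inr i))) =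
        z := by ext; simp
    simpa only [map_polyOp, h1, h2, h3] using this
  · have := generic (polyOp P 0 X) X fun x => by simp only [map_polyOp, comp_zero_fun, comp_aeval_X, zero_op]
    simpa only [map_polyOp, comp_zero_fun, comp_aeval_X] using congrArg (fun u => (aeval x : _ →ₐ[k] B) ∘ u) this
  · have := generic (polyOp P X 0) X fun x => by simp only [map_polyOp, comp_zero_fun, comp_aeval_X, op_zero]
    simpa only [map_polyOp, comp_zero_fun, comp_aeval_X] using congrArg (fun u => (aeval x : _ →ₐ[k] B) ∘ u) this
  · have := generic (polyOp P (polyMap S X) X) 0 fun x => by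
      simp only [map_polyOp, map_polyMap, comp_zero_fun, comp_aeval_X, inv_op]
    simpa only [map_polyOp, map_polyMap, comp_zero_fun, comp_aeval_X]
      using congrArg (fun u => (aeval x : _ →ₐ[k] B) ∘ u) this
  · have := generic (polyOp P X (polyMap S X)) 0 fun x => by
      simp only [map_polyOp, map_polyMap, comp_zero_fun, comp_aeval_X, op_inv]
    simpa only [map_polyOp, map_polyMap, comp_zero_fun, comp_aeval_X]
      using congrArg (fun u => (aeval x : _ →ₐ[k] B) ∘ u) this

namespace IsPolyGroupLaw

universe v

variable {J k : Type v} [Field k] {P : J → MvPolynomial (J ⊕ J) k} {S : J → MvPolynomial J k}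

/-- The comultiplication on the coordinate ring of affine space dual to the operation `P`. -/
def comul (P : J → MvPolynomial (J ⊕ J) k) :
    MvPolynomial J k →ₐ[k] MvPolynomial J k ⊗[k] MvPolynomial J k :=
  aeval (polyOp P (fun i => X i ⊗ₜ 1) (fun i => 1 ⊗ₜ X i))

theorem comp_comul_X {B : Type*} [CommRing B] [Algebra k B]
    (φ : MvPolynomial J k ⊗[k] MvPolynomial J k →ₐ[k] B) (j : J) :
    φ (comul P (X j)) = polyOp P (fun i => φ (X i ⊗ₜ 1)) (fun i => φ (1 ⊗ₜ X i)) j := by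
  rw [comul, aeval_X]
  exact congrFun (map_polyOp φ P _ _) j

/-- The bialgebra structure on the coordinate ring of affine space dual to a polynomial group
law. -/
abbrev bialgebra (h : IsPolyGroupLaw.{v, v, v} P S) : Bialgebra k (MvPolynomial J k) :=
  Bialgebra.ofAlgHom (comul P) (aeval (0 : J → k))
    (by
      refine MvPolynomial.algHom_ext fun j => ?_
      -- The universal triple of points: coassociativity is associativity of `P` at `x₁, x₂, x₃`.
      let x₁ : J → MvPolynomial J k ⊗[k] (MvPolynomial J k ⊗[k] MvPolynomial J k) :=
        fun i => X i ⊗ₜ (1 ⊗ₜ 1)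
      let x₂ : J → MvPolynomial J k ⊗[k] (MvPolynomial J k ⊗[k] MvPolynomial J k) :=
        fun i => 1 ⊗ₜ (X i ⊗ₜ 1)
      let x₃ : J → MvPolynomial J k ⊗[k] (MvPolynomial J k ⊗[k] MvPolynomial J k) :=
        fun i => 1 ⊗ₜ (1 ⊗ₜ X i)
      have h1 : ∀ i, (Algebra.TensorProduct.assoc k k k (MvPolynomial J k) (MvPolynomial J k)
          (MvPolynomial J k)).toAlgHom (comul P (X i) ⊗ₜ 1) = polyOp P x₁ x₂ i := fun i => by
        exact comp_comul_X (P := P)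
          (B := MvPolynomial J k ⊗[k] (MvPolynomial J k ⊗[k] MvPolynomial J k))
          ((Algebra.TensorProduct.assoc k k k (MvPolynomial J k) (MvPolynomial J k)
          (MvPolynomial J k)).toAlgHom.comp (Algebra.TensorProduct.includeLeft :
          MvPolynomial J k ⊗[k] MvPolynomial J k →ₐ[k] _)) i
      have h2 : ∀ i, (1 : MvPolynomial J k) ⊗ₜ[k] comul P (X i) = polyOp P x₂ x₃ i := fun i =>
        comp_comul_X (P := P)
          (B := MvPolynomial J k ⊗[k] (MvPolynomial J k ⊗[k] MvPolynomial J k))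
          (Algebra.TensorProduct.includeRight :
          _ →ₐ[k] MvPolynomial J k ⊗[k] (MvPolynomial J k ⊗[k] MvPolynomial J k)) i
      have hl := comp_comul_X (P := P)
        (B := MvPolynomial J k ⊗[k] (MvPolynomial J k ⊗[k] MvPolynomial J k))
        ((Algebra.TensorProduct.assoc k k k (MvPolynomial J k) (MvPolynomial J k)
        (MvPolynomial J k)).toAlgHom.comp
        (Algebra.TensorProduct.map (comul P) (.id k (MvPolynomial J k)))) j
      have hr := comp_comul_X (P := P)
        (B := MvPolynomial J k ⊗[k] (MvPolynomial J k ⊗[k] MvPolynomial J k))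
        (Algebra.TensorProduct.map (.id k (MvPolynomial J k)) (comul P)) j
      simp only [AlgHom.comp_apply, Algebra.TensorProduct.map_tmul, map_one, AlgHom.id_apply,
        h1, h2] at hl hr ⊢
      rw [hl, hr]
      exact congrFun (h.assoc _ x₁ x₂ x₃) j)
    (by
      refine MvPolynomial.algHom_ext fun j => ?_
      have := comp_comul_X (P := P) (Algebra.TensorProduct.map (aeval (0 : J → k))
        (.id k (MvPolynomial J k))) j
      rw [AlgHom.comp_apply, this]
      simp only [Algebra.TensorProduct.map_tmul, aeval_X, Pi.zero_apply, TensorProduct.zero_tmul,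
        map_one, AlgHom.id_apply]
      exact congrFun (h.zero_op _ _) j)
    (by
      refine MvPolynomial.algHom_ext fun j => ?_
      have := comp_comul_X (P := P) (Algebra.TensorProduct.map (.id k (MvPolynomial J k))
        (aeval (0 : J → k))) j
      rw [AlgHom.comp_apply, this]
      simp only [Algebra.TensorProduct.map_tmul, aeval_X, Pi.zero_apply, TensorProduct.tmul_zero,
        map_one, AlgHom.id_apply]
      exact congrFun (h.op_zero _ _) j)

/-- The Hopf algebra structure on the coordinate ring of affine space dual to a polynomial group
law. -/
abbrev hopfAlgebra (h : IsPolyGroupLaw.{v, v, v} P S) : HopfAlgebra k (MvPolynomial J k) :=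
  letI := h.bialgebra
  HopfAlgebra.ofAlgHom (aeval S)
    (by
      refine MvPolynomial.algHom_ext fun j => ?_
      have h1 := comp_comul_X (P := P) (Algebra.TensorProduct.lift (aeval S)
        (.id k (MvPolynomial J k)) fun _ _ => Commute.all _ _) j
      have h2 := congrFun (h.inv_op (MvPolynomial J k) X) j
      have h3 : Bialgebra.counitAlgHom k (MvPolynomial J k) (X j) = 0 :=
        aeval_X (0 : J → k) j
      refine h1.trans ?_
      rw [AlgHom.comp_apply, h3, map_zero]
      have hS : polyMap S X = S := _root_.funext fun i => aeval_X_left_apply (S i)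
      rw [hS] at h2
      simp only [Algebra.TensorProduct.lift_tmul, map_one, _root_.one_mul, _root_.mul_one, aeval_X,
        AlgHom.id_apply]
      exact h2)
    (by
      refine MvPolynomial.algHom_ext fun j => ?_
      have h1 := comp_comul_X (P := P) (Algebra.TensorProduct.lift (.id k (MvPolynomial J k))
        (aeval S) fun _ _ => Commute.all _ _) j
      have h2 := congrFun (h.op_inv (MvPolynomial J k) X) j
      have h3 : Bialgebra.counitAlgHom k (MvPolynomial J k) (X j) = 0 :=
        aeval_X (0 : J → k) j
      refine h1.trans ?_
      rw [AlgHom.comp_apply, h3, map_zero]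
      have hS : polyMap S X = S := _root_.funext fun i => aeval_X_left_apply (S i)
      rw [hS] at h2
      simp only [Algebra.TensorProduct.lift_tmul, map_one, _root_.one_mul, _root_.mul_one, aeval_X,
        AlgHom.id_apply]
      exact h2)

end IsPolyGroupLaw

end PolynomialGroupLaw

/-! ### Gradings, checked on generators -/

section Graded

open MvPolynomial

/-- A weighted homogeneous polynomial maps homogeneous elements whose degrees are the weights to
homogeneous elements. -/
theorem MvPolynomial.IsWeightedHomogeneous.aeval_mem {J k B : Type*} [CommRing k] [CommRing B]
    [Algebra k B] (M : ℕ → Submodule k B) [SetLike.GradedMonoid M] {w : J → ℕ} {f : J → B}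
    (hf : ∀ i, f i ∈ M (w i)) {p : MvPolynomial J k} {n : ℕ}
    (hp : p.IsWeightedHomogeneous w n) : aeval f p ∈ M n := by
  rw [aeval_def, eval₂_eq]
  refine Submodule.sum_mem _ fun d hd => ?_
  rw [← Algebra.smul_def]
  refine Submodule.smul_mem _ _ ?_
  have := SetLike.prod_pow_mem_graded M w f (F := d.support) d fun i _ => hf i
  rwa [← hp (mem_support_iff.1 hd), Finsupp.weight_apply]

/-- The total grading on the tensor square of a graded algebra, spanned by the homogeneous pure
tensors. -/
def tensorGrading {k A : Type*} [Field k] [CommRing A] [Algebra k A] (𝒜 : ℕ → Submodule k A)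
    (n : ℕ) : Submodule k (A ⊗[k] A) :=
  Submodule.span k {t | ∃ p q, p + q = n ∧ ∃ a ∈ 𝒜 p, ∃ b ∈ 𝒜 q, t = a ⊗ₜ b}

section

variable {k A : Type*} [Field k] [CommRing A] [Algebra k A] (𝒜 : ℕ → Submodule k A)

theorem tmul_mem_tensorGrading {p q : ℕ} {a b : A} (ha : a ∈ 𝒜 p) (hb : b ∈ 𝒜 q) :
    a ⊗ₜ b ∈ tensorGrading 𝒜 (p + q) :=
  Submodule.subset_span ⟨p, q, rfl, a, ha, b, hb, rfl⟩

/-- Because of this, homogeneity of the coproduct, an algebra map, need only be tested on the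
generators. -/
instance [SetLike.GradedMonoid 𝒜] : SetLike.GradedMonoid (tensorGrading 𝒜) where
  one_mem := by
    rw [Algebra.TensorProduct.one_def]
    exact tmul_mem_tensorGrading 𝒜 (p := 0) (q := 0) (SetLike.one_mem_graded 𝒜)
      (SetLike.one_mem_graded 𝒜)
  mul_mem m n x y hx hy := by
    have h : tensorGrading 𝒜 m * tensorGrading 𝒜 n ≤ tensorGrading 𝒜 (m + n) := by
      rw [tensorGrading, tensorGrading, Submodule.span_mul_span, Submodule.span_le]
      rintro _ ⟨_, ⟨p, q, rfl, a, ha, b, hb, rfl⟩, _, ⟨p', q', rfl, a', ha', b', hb', rfl⟩, rfl⟩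
      have := tmul_mem_tensorGrading 𝒜 (SetLike.mul_mem_graded ha ha')
        (SetLike.mul_mem_graded hb hb')
      rw [add_add_add_comm] at this
      dsimp only
      rwa [Algebra.TensorProduct.tmul_mul_tmul]
    exact h (Submodule.mul_mem_mul hx hy)

theorem tensorGrading_le (n : ℕ) : tensorGrading 𝒜 n ≤
    ⨆ p ∈ Finset.HasAntidiagonal.antidiagonal n,
      LinearMap.range (TensorProduct.map (𝒜 p.1).subtype (𝒜 p.2).subtype) := by
  refine Submodule.span_le.2 ?_
  rintro _ ⟨p, q, hpq, a, ha, b, hb, rfl⟩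
  exact Submodule.mem_iSup_of_mem (p, q) (Submodule.mem_iSup_of_mem
    (Finset.HasAntidiagonal.mem_antidiagonal.2 hpq) ⟨⟨a, ha⟩ ⊗ₜ ⟨b, hb⟩, rfl⟩)

end

theorem gradedMonoid_map_weightedHomogeneousSubmodule {J k A : Type*} [CommRing k] [CommRing A]
    [Algebra k A] (σ : J → ℕ) (e : MvPolynomial J k ≃ₐ[k] A) :
    SetLike.GradedMonoid fun m => (weightedHomogeneousSubmodule k σ m).map e.toLinearMap where
  one_mem := ⟨1, isWeightedHomogeneous_one k σ, map_one e⟩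
  mul_mem := by
    rintro m n _ _ ⟨p, hp, rfl⟩ ⟨q, hq, rfl⟩
    exact ⟨p * q, IsWeightedHomogeneous.mul hp hq, map_mul e p q⟩

variable {k A J : Type*} [Field k] [CommRing A] [HopfAlgebra k A]

theorem algHom_apply_eq_aeval {J k A B : Type*} [CommRing k] [CommRing A] [Algebra k A]
    [CommRing B] [Algebra k B] (e : MvPolynomial J k ≃ₐ[k] A) (φ : A →ₐ[k] B)
    (p : MvPolynomial J k) : φ (e p) = aeval (fun i => φ (e (X i))) p :=
  congrArg (fun ψ => ψ p) (algHom_ext (f := φ.comp e.toAlgHom)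
    (g := aeval (fun i => φ (e (X i)))) fun i => by simp)

theorem aeval_mem_tensorGrading {J k A : Type*} [Field k] [CommRing A] [Algebra k A]
    (σ : J → ℕ) (e : MvPolynomial J k ≃ₐ[k] A) {n : ℕ} {p : MvPolynomial (J ⊕ J) k}
    (hp : p.IsWeightedHomogeneous (Sum.elim σ σ) n) :
    aeval (Sum.elim (fun i => e (X i) ⊗ₜ[k] (1 : A)) (fun i => (1 : A) ⊗ₜ[k] e (X i))) p ∈
      tensorGrading (fun m => (weightedHomogeneousSubmodule k σ m).map e.toLinearMap) n := by
  let 𝒜 : ℕ → Submodule k A := fun m => (weightedHomogeneousSubmodule k σ m).map e.toLinearMap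
  have : SetLike.GradedMonoid 𝒜 := gradedMonoid_map_weightedHomogeneousSubmodule σ e
  have hX : ∀ i, e (X i) ∈ 𝒜 (σ i) := fun i => ⟨X i, isWeightedHomogeneous_X k σ i, rfl⟩
  refine IsWeightedHomogeneous.aeval_mem (B := A ⊗[k] A) (tensorGrading 𝒜) ?_ hp
  rintro (i | i)
  · exact tmul_mem_tensorGrading 𝒜 (q := 0) (hX i) (SetLike.one_mem_graded 𝒜)
  · have h := tmul_mem_tensorGrading 𝒜 (p := 0) (SetLike.one_mem_graded 𝒜) (hX i)
    rwa [zero_add] at h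

/-- A Hopf algebra structure on a polynomial ring with positive weights is graded connected if
the generators have homogeneous coproducts and antipodes and vanishing counits. -/
theorem isGradedConnectedHopfAlgebra_of_generators {σ : J → ℕ} (hσ : ∀ j, σ j ≠ 0)
    (e : MvPolynomial J k ≃ₐ[k] A)
    (comul_mem : ∀ j, Coalgebra.comul (R := k) (e (X j)) ∈
      tensorGrading (fun m => (weightedHomogeneousSubmodule k σ m).map e.toLinearMap) (σ j))
    (counit_eq : ∀ j, Coalgebra.counit (R := k) (e (X j)) = 0)
    (antipode_mem : ∀ j, HopfAlgebra.antipode k (e (X j)) ∈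
      (weightedHomogeneousSubmodule k σ (σ j)).map e.toLinearMap) :
    IsGradedConnectedHopfAlgebra k A
      (fun m => (weightedHomogeneousSubmodule k σ m).map e.toLinearMap) := by
  classical
  set 𝒜 : ℕ → Submodule k A := fun m => (weightedHomogeneousSubmodule k σ m).map e.toLinearMap
    with h𝒜
  have : SetLike.GradedMonoid 𝒜 := gradedMonoid_map_weightedHomogeneousSubmodule σ e
  refine ⟨?_, SetLike.one_mem_graded 𝒜, fun ha hb => SetLike.mul_mem_graded ha hb, ?_, ?_, ?_, ?_⟩
  · have hint : DirectSum.IsInternal (weightedHomogeneousSubmodule k σ) :=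
      letI := weightedDecomposition k σ
      DirectSum.Decomposition.isInternal _
    rw [DirectSum.isInternal_submodule_iff_iSupIndep_and_iSup_eq_top] at hint ⊢
    refine ⟨hint.1.map_orderIso (Submodule.orderIsoMapComap e.toLinearEquiv), ?_⟩
    rw [h𝒜, ← Submodule.map_iSup, hint.2, Submodule.map_top]
    exact LinearEquiv.range e.toLinearEquiv
  · rintro n _ ⟨p, hp, rfl⟩
    refine tensorGrading_le 𝒜 n ?_
    have := algHom_apply_eq_aeval e (Bialgebra.comulAlgHom k A) p
    refine (congrArg (· ∈ tensorGrading 𝒜 n) this).mpr ?_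
    exact IsWeightedHomogeneous.aeval_mem (tensorGrading 𝒜) comul_mem hp
  · rintro n _ ⟨p, hp, rfl⟩ hn
    refine (algHom_apply_eq_aeval e (Bialgebra.counitAlgHom k A) p).trans ?_
    have h0 : (fun i => Bialgebra.counitAlgHom k A (e (X i))) = 0 := _root_.funext counit_eq
    rw [h0, aeval_zero]
    exact IsWeightedHomogeneous.coeff_eq_zero hp 0 (by simpa using hn.symm)
  · rintro n _ ⟨p, hp, rfl⟩
    have := algHom_apply_eq_aeval e (HopfAlgebra.antipodeAlgHom k A) p
    refine (congrArg (· ∈ 𝒜 n) this).mpr ?_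
    exact IsWeightedHomogeneous.aeval_mem 𝒜 antipode_mem hp
  · refine le_antisymm ?_ ((Submodule.span_singleton_le_iff_mem _ _).2 (SetLike.one_mem_graded 𝒜))
    rintro _ ⟨p, hp, rfl⟩
    -- Positive weights enter here: only constants have weighted degree `0`.
    have h := weightedHomogeneousComponent_zero p hσ
    rw [IsWeightedHomogeneous.weightedHomogeneousComponent_same hp] at h
    refine Submodule.mem_span_singleton.2 ⟨coeff 0 p, ?_⟩
    rw [h, coeff_zero_C, ← _root_.mul_one (C _), ← smul_eq_C_mul]
    simp

end Graded

/-! ### Smoothness and the group of points -/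

section Points

open MvPolynomial

universe v

/-- The coordinate ring of affine space is smooth over the base field. -/
theorem smooth_Spec_of_algEquiv {J k A : Type v} [Finite J] [Field k] [CommRing A] [Algebra k A]
    (e : MvPolynomial J k ≃ₐ[k] A) : Smooth (Spec (.of A) ↘ Spec (.of k)) := by
  have : Algebra.Smooth k (MvPolynomial J k) := ⟨inferInstance, inferInstance⟩
  have : Algebra.Smooth k A := Algebra.Smooth.of_equiv e
  rw [specOverSpec_over, HasRingHomProperty.Spec_iff (P := @Smooth)]
  exact (RingHom.smooth_algebraMap (R := k) (S := A)).2 this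

/-- The `K`-points of the coordinate ring of affine space with coproduct dual to the polynomial
operation `P` form a group isomorphic to `G`, if `P` gives the group law on `G`. -/
theorem exists_points_mulEquiv {J k A K : Type v} [Field k] [CommRing A] [HopfAlgebra k A]
    [CommRing K] [Algebra k K] {G : Type*} [Group G] (c : G ≃ (J → K))
    {P : J → MvPolynomial (J ⊕ J) k} (hc : ∀ x y, c (x * y) = polyOp P (c x) (c y))
    (e : MvPolynomial J k ≃ₐ[k] A)
    (hcomul : ∀ j, Coalgebra.comul (R := k) (e (X j)) =
      polyOp P (fun i => e (X i) ⊗ₜ 1) (fun i => 1 ⊗ₜ e (X i)) j) :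
    ∃ Φ : ((Spec (.of K)).asOver (Spec (.of k)) ⟶ (Spec (.of A)).asOver (Spec (.of k))) ≃* G,
      ∀ (f : A →ₐ[k] K) (j : J), c (Φ (Spec.mapMulEquiv (WithConv.toConv f))) j = f (e (X j)) := by
  let Ψ : WithConv (A →ₐ[k] K) ≃* G :=
    { toFun := fun f => c.symm fun j => f.ofConv (e (X j))
      invFun := fun g => WithConv.toConv ((aeval (c g)).comp e.symm.toAlgHom)
      left_inv := fun f => by
        apply WithConv.ofConv_injective
        have : (f.ofConv.comp e.toAlgHom) = aeval fun j => f.ofConv (e (X j)) := by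
          ext; simp
        simp only [Equiv.apply_symm_apply, ← this]
        ext; simp
      right_inv := fun g => by simp
      map_mul' := fun f g => by
        apply c.injective
        rw [hc]
        funext j
        simp only [Equiv.apply_symm_apply]
        have h := congrFun (map_polyOp (Algebra.TensorProduct.lift f.ofConv g.ofConv
          fun _ _ => Commute.all _ _) P (fun i => e (X i) ⊗ₜ 1) (fun i => 1 ⊗ₜ e (X i))) j
        rw [Function.comp_apply, ← hcomul] at h
        -- The convolution product is `Δ` followed by the map induced by `f` and `g`, which sends
        -- the universal pair of points to the pair `f, g`.
        have h' : (f * g).ofConv (e (X j)) = Algebra.TensorProduct.lift f.ofConv g.ofConv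
          (fun _ _ => Commute.all _ _) (Coalgebra.comul (R := k) (e (X j))) := by
          rw [AlgHom.convMul_def]
          simp [← Algebra.TensorProduct.lmul'_comp_map]
        rw [h', h]
        simp [Function.comp_def] }
  exact ⟨Spec.mapMulEquiv.symm.trans Ψ, fun f j => by simp [Ψ]⟩

end Points

/-! ### Smooth homogeneous functions are polynomials -/

section Homogeneous

open MvPolynomial Filter Topology

/-- The weighted dilation of `ℝ^τ` with factor `t`. -/
def dilation {τ : Type*} (w : τ → ℕ) (t : ℝ) : (τ → ℝ) →L[ℝ] (τ → ℝ) :=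
  ContinuousLinearMap.pi fun i => (t ^ w i) • ContinuousLinearMap.proj i

@[simp] theorem dilation_apply {τ : Type*} (w : τ → ℕ) (t : ℝ) (z : τ → ℝ) (i : τ) :
    dilation w t z i = t ^ w i * z i := by
  simp [dilation]

theorem tendsto_dilation_zero {τ : Type*} {w : τ → ℕ} (hw : ∀ i, w i ≠ 0) {f : (τ → ℝ) → ℝ}
    (hf : Continuous f) (z : τ → ℝ) :
    Tendsto (fun t => f (dilation w t z)) (𝓝[≠] 0) (𝓝 (f 0)) := by
  have hc : Continuous fun t => f (dilation w t z) :=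
    hf.comp (continuous_pi fun i => by simp only [dilation_apply]; fun_prop)
  have h0 : dilation w 0 z = 0 := by ext i; simp [hw i]
  have := (hc.tendsto 0).mono_left (nhdsWithin_le_nhds (s := {0}ᶜ))
  rwa [h0] at this

/-- Euler's identity for a weighted homogeneous function. -/
theorem euler_identity {τ : Type*} [Fintype τ] [DecidableEq τ] {w : τ → ℕ} {m : ℕ}
    {f : (τ → ℝ) → ℝ} (hf : Differentiable ℝ f)
    (hom : ∀ t : ℝ, t ≠ 0 → ∀ z, f (dilation w t z) = t ^ m * f z) (z : τ → ℝ) :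
    ∑ i, (w i * z i) * fderiv ℝ f z (Pi.single i 1) = m * f z := by
  have h1 : dilation w 1 z = z := by ext i; simp
  have hcurve : HasDerivAt (fun t => dilation w t z) (fun i => w i * z i) 1 := by
    rw [hasDerivAt_pi]
    intro i
    simp only [dilation_apply]
    simpa using (hasDerivAt_pow (w i) (1 : ℝ)).mul_const (z i)
  have hl : HasDerivAt (fun t => f (dilation w t z)) (fderiv ℝ f z fun i => w i * z i) 1 := by
    have hd : HasFDerivAt f (fderiv ℝ f z) (dilation w 1 z) := by
      rw [h1]; exact (hf z).hasFDerivAt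
    exact hd.comp_hasDerivAt 1 hcurve
  have hr : HasDerivAt (fun t : ℝ => t ^ m * f z) (m * f z) 1 := by
    simpa using (hasDerivAt_pow m (1 : ℝ)).mul_const (f z)
  have heq : (fun t => f (dilation w t z)) =ᶠ[𝓝 1] fun t : ℝ => t ^ m * f z := by
    filter_upwards [isOpen_ne.mem_nhds (one_ne_zero (α := ℝ))] with t ht using hom t ht z
  rw [← (hl.congr_of_eventuallyEq heq.symm).unique hr]
  conv_rhs => rw [pi_eq_sum_univ' (fun i => (w i : ℝ) * z i), map_sum]
  refine Finset.sum_congr rfl fun i _ => ?_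
  rw [map_smul, smul_eq_mul]

theorem fderiv_dilation {τ : Type*} [DecidableEq τ] [Fintype τ] {w : τ → ℕ} {m : ℕ}
    {f : (τ → ℝ) → ℝ} (hf : Differentiable ℝ f) {t : ℝ}
    (hom : ∀ z, f (dilation w t z) = t ^ m * f z) (z : τ → ℝ) (i : τ) :
    t ^ w i * fderiv ℝ f (dilation w t z) (Pi.single i 1) =
      t ^ m * fderiv ℝ f z (Pi.single i 1) := by
  have hl : HasFDerivAt (fun z => f (dilation w t z))
      ((fderiv ℝ f (dilation w t z)).comp (dilation w t)) z :=
    (hf _).hasFDerivAt.comp z (dilation w t).hasFDerivAt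
  have hr : HasFDerivAt (fun z => t ^ m * f z) (t ^ m • fderiv ℝ f z) z :=
    (hf z).hasFDerivAt.const_mul _
  rw [funext hom] at hl
  have h := congrArg (fun L => L (Pi.single i 1)) (hl.unique hr)
  have hs : dilation w t (Pi.single i 1) = t ^ w i • Pi.single i 1 := by
    ext j
    by_cases hj : j = i
    · subst hj; simp
    · simp [hj]
  simpa [hs] using h

/-- A smooth function that is homogeneous with respect to a dilation with positive weights is a
weighted homogeneous polynomial. -/
theorem exists_polynomial_of_homogeneous {τ : Type*} [Fintype τ] {w : τ → ℕ}
    (hw : ∀ i, w i ≠ 0) (m : ℕ) {f : (τ → ℝ) → ℝ} (hf : ContDiff ℝ ∞ f)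
    (hom : ∀ t : ℝ, t ≠ 0 → ∀ z, f (dilation w t z) = t ^ m * f z) :
    ∃ p : MvPolynomial τ ℝ, p.IsWeightedHomogeneous w m ∧ ∀ z, f z = eval z p := by
  classical
  induction m using Nat.strong_induction_on generalizing f with
  | _ m ih =>
  rcases eq_or_ne m 0 with rfl | hm
  · refine ⟨C (f 0), isWeightedHomogeneous_C w _, fun z => ?_⟩
    rw [eval_C]
    refine tendsto_nhds_unique (Tendsto.congr' ?_ tendsto_const_nhds)
      (tendsto_dilation_zero hw hf.continuous z)
    filter_upwards [self_mem_nhdsWithin] with t ht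
    rw [hom t ht, pow_zero, _root_.one_mul]
  have hdiff : Differentiable ℝ f := hf.differentiable (by simp)
  have hsmooth : ∀ i : τ, ContDiff ℝ ∞ fun z => fderiv ℝ f z (Pi.single i 1) := fun i =>
    (hf.fderiv_right (m := ∞) (by simp)).clm_apply contDiff_const
  -- Stating homogeneity for `q * X i` avoids truncated subtraction when `w i > m`. In that case the
  -- derivative is zero: it equals `t ^ (w i - m)` times its value at the dilated point, which tends
  -- to `0` with `t`.
  have hq : ∀ i, ∃ q : MvPolynomial τ ℝ, (q * X i).IsWeightedHomogeneous w m ∧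
      ∀ z, fderiv ℝ f z (Pi.single i 1) = eval z q := by
    intro i
    by_cases hi : w i ≤ m
    · obtain ⟨q, hq, hfq⟩ := ih (m - w i) (by have := hw i; omega) (hsmooth i) fun t ht z => by
        have h := fderiv_dilation hdiff (hom t ht) z i
        rw [← Nat.add_sub_cancel' hi, pow_add, _root_.mul_assoc] at h
        simpa using mul_left_cancel₀ (pow_ne_zero _ ht) h
      refine ⟨q, ?_, hfq⟩
      have := hq.mul (isWeightedHomogeneous_X ℝ w i)
      rwa [Nat.sub_add_cancel hi] at this
    · refine ⟨0, by rw [zero_mul]; exact isWeightedHomogeneous_zero ℝ w m, fun z => ?_⟩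
      rw [map_zero]
      have hlim : Tendsto (fun t : ℝ => t ^ (w i - m) *
          fderiv ℝ f (dilation w t z) (Pi.single i 1)) (𝓝[≠] 0) (𝓝 0) := by
        have h0 : Tendsto (fun t : ℝ => t ^ (w i - m)) (𝓝[≠] 0) (𝓝 0) := by
          have := ((continuous_pow (M := ℝ) (w i - m)).tendsto 0).mono_left
            (nhdsWithin_le_nhds (s := {0}ᶜ))
          rwa [zero_pow (by omega)] at this
        simpa using h0.mul (tendsto_dilation_zero hw (hsmooth i).continuous z)
      refine tendsto_nhds_unique (Tendsto.congr' ?_ tendsto_const_nhds) hlim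
      filter_upwards [self_mem_nhdsWithin] with t ht
      have h := fderiv_dilation hdiff (hom t ht) z i
      rw [← Nat.add_sub_cancel' (le_of_not_ge hi), pow_add, _root_.mul_assoc] at h
      exact (mul_left_cancel₀ (pow_ne_zero _ ht) h).symm
  choose q hq hfq using hq
  refine ⟨C (m : ℝ)⁻¹ * ∑ i, C (w i : ℝ) * (q i * X i),
    (IsWeightedHomogeneous.sum _ _ _ fun i _ => (hq i).C_mul _).C_mul _, fun z => ?_⟩
  have h := euler_identity hdiff hom z
  have hm' : (m : ℝ) ≠ 0 := Nat.cast_ne_zero.2 hm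
  rw [eval_mul, eval_C, eq_inv_mul_iff_mul_eq₀ hm', ← h, map_sum]
  refine Finset.sum_congr rfl fun i _ => ?_
  simp [hfq]
  ring

end Homogeneous

/-! ### Correction terms and polynomial inversion -/

section CorrectionTerms

open MvPolynomial

/-- If a polynomial vanishes wherever the variables in `s` vanish, then each of its monomials
contains a variable in `s`. -/
theorem MvPolynomial.exists_mem_ne_zero_of_eval_eq_zero {τ K : Type*} [Fintype τ] [Field K]
    [Infinite K] (s : Set τ) {p : MvPolynomial τ K}
    (h : ∀ z : τ → K, (∀ i ∈ s, z i = 0) → eval z p = 0) {d : τ →₀ ℕ} (hd : d ∈ p.support) :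
    ∃ i ∈ s, d i ≠ 0 := by
  classical
  by_contra! hcon
  set T := p.support.filter fun d => ∀ i ∈ s, d i = 0 with hT
  -- The part of `p` free of the variables in `s` takes at `z` the value of `p` at `z` with those
  -- coordinates set to `0`.
  have hp : ∑ b ∈ T, monomial b (coeff b p) = 0 := by
    refine MvPolynomial.funext fun z => ?_
    rw [map_zero, ← h (fun i => if i ∈ s then 0 else z i) fun i hi => if_pos hi, map_sum, eval_eq',
      hT, Finset.sum_filter]
    refine Finset.sum_congr rfl fun b _ => ?_
    split_ifs with hb
    · rw [eval_monomial, Finsupp.prod_fintype _ _ fun i => pow_zero _]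
      congr 1
      refine Finset.prod_congr rfl fun i _ => ?_
      by_cases hi : i ∈ s
      · simp [hb i hi]
      · simp [hi]
    · push Not at hb
      obtain ⟨i, hi, hbi⟩ := hb
      rw [Finset.prod_eq_zero (Finset.mem_univ i) (by simp [hi, hbi]), mul_zero]
  have hcoeff := congrArg (coeff d) hp
  rw [coeff_sum, coeff_zero, Finset.sum_eq_single d] at hcoeff
  · rw [coeff_monomial, if_pos rfl] at hcoeff
    exact mem_support_iff.1 hd hcoeff
  · intro b _ hb
    rw [coeff_monomial, if_neg hb]
  · intro hdT
    exact absurd (Finset.mem_filter.2 ⟨hd, hcon⟩) hdT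

variable {N : ℕ} {σ : Fin N → ℕ}

/-- The condition on the variables of a correction term follows from the other two conditions. -/
theorem IsCorrectionTerm.of_homogeneous_of_mixed (hσ : ∀ j, 1 ≤ σ j) (hmono : Monotone σ)
    {k : Type*} [Field k] {j : Fin N} {q : MvPolynomial (Fin N ⊕ Fin N) k}
    (hom : q.IsWeightedHomogeneous (Sum.elim σ σ) (σ j))
    (mixed : ∀ d ∈ q.support, (∃ i, d (Sum.inl i) ≠ 0) ∧ (∃ i, d (Sum.inr i) ≠ 0)) :
    IsCorrectionTerm σ j q := by
  refine ⟨hom, mixed, fun i hi => ?_⟩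
  suffices h : σ i < σ j from ⟨lt_of_not_ge fun hji => absurd (hmono hji) (not_le.2 h), h⟩
  -- As all weights are at least `1`, a mixed monomial of weight `σ j` forces both `σ a` and `σ b`
  -- below `σ j`.
  have key : ∀ d ∈ q.support, ∀ a b, d (Sum.inl a) ≠ 0 → d (Sum.inr b) ≠ 0 →
      σ a + σ b ≤ σ j := by
    intro d hd a b ha hb
    have hw := hom (mem_support_iff.1 hd)
    rw [Finsupp.weight_apply, Finsupp.sum_fintype _ _ (by simp), Fintype.sum_sum_type] at hw
    have h1 := Finset.single_le_sum (f := fun i => d (Sum.inl i) • Sum.elim σ σ (Sum.inl i))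
      (fun _ _ => Nat.zero_le _) (Finset.mem_univ a)
    have h2 := Finset.single_le_sum (f := fun i => d (Sum.inr i) • Sum.elim σ σ (Sum.inr i))
      (fun _ _ => Nat.zero_le _) (Finset.mem_univ b)
    simp only [Sum.elim_inl, Sum.elim_inr, smul_eq_mul] at h1 h2 hw
    have h3 := Nat.le_mul_of_pos_left (σ a) (Nat.pos_of_ne_zero ha)
    have h4 := Nat.le_mul_of_pos_left (σ b) (Nat.pos_of_ne_zero hb)
    omega
  rcases hi with hi | hi
  · obtain ⟨d, hd, hdi⟩ := (mem_vars_iff_mem_support _).1 hi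
    obtain ⟨b, hb⟩ := (mixed d hd).2
    have := key d hd i b (Finsupp.mem_support_iff.1 hdi) hb
    have := hσ b
    omega
  · obtain ⟨d, hd, hdi⟩ := (mem_vars_iff_mem_support _).1 hi
    obtain ⟨a, ha⟩ := (mixed d hd).1
    have := key d hd a i ha (Finsupp.mem_support_iff.1 hdi)
    have := hσ a
    omega

theorem IsCorrectionTerm.of_map {k K : Type*} [Field k] [Field K] (φ : k →+* K) {j : Fin N}
    {q : MvPolynomial (Fin N ⊕ Fin N) k} (h : IsCorrectionTerm σ j (map φ q)) :
    IsCorrectionTerm σ j q where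
  homogeneous := fun d hd => h.homogeneous (by
    rw [coeff_map]; exact (map_ne_zero φ).2 hd)
  mixed := by
    have := h.mixed
    rwa [support_map_of_injective q φ.injective] at this
  lower := by
    classical
    have := h.lower
    rwa [vars_map_of_injective q φ.injective] at this

/-- The group law `x + y + Q(x, y)` with correction terms `Q`. -/
def correctedSum {k : Type*} [Field k] (Q : Fin N → MvPolynomial (Fin N ⊕ Fin N) k) (j : Fin N) :
    MvPolynomial (Fin N ⊕ Fin N) k :=
  X (Sum.inl j) + X (Sum.inr j) + Q j

theorem polyOp_correctedSum {k B : Type*} [Field k] [CommRing B] [Algebra k B]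
    (Q : Fin N → MvPolynomial (Fin N ⊕ Fin N) k) (x y : Fin N → B) (j : Fin N) :
    polyOp (correctedSum Q) x y j = x j + y j + aeval (Sum.elim x y) (Q j) := by
  simp [polyOp, correctedSum]

theorem isWeightedHomogeneous_correctedSum {k : Type*} [Field k]
    {Q : Fin N → MvPolynomial (Fin N ⊕ Fin N) k} (hQ : ∀ j, IsCorrectionTerm σ j (Q j))
    (j : Fin N) : (correctedSum Q j).IsWeightedHomogeneous (Sum.elim σ σ) (σ j) :=
  ((isWeightedHomogeneous_X k (Sum.elim σ σ) (Sum.inl j)).add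
    (isWeightedHomogeneous_X k (Sum.elim σ σ) (Sum.inr j))).add (hQ j).homogeneous

/-- The polynomials defining the inversion of the group law `x + y + Q(x, y)`. -/
def inversePoly {k : Type*} [Field k] (Q : Fin N → MvPolynomial (Fin N ⊕ Fin N) k) (j : Fin N) :
    MvPolynomial (Fin N) k :=
  -- This solves `x_j + y_j + Q_j(x, y) = 0` for `y_j`. The guard makes the recursion well-founded;
  -- for correction terms its default `0` is never seen, as `Q j` involves only indices below `j`.
  -X j - aeval (Sum.elim X fun i => if _h : i < j then inversePoly Q i else 0) (Q j)
termination_by j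

theorem isWeightedHomogeneous_inversePoly {k : Type*} [Field k]
    {Q : Fin N → MvPolynomial (Fin N ⊕ Fin N) k} (hQ : ∀ j, IsCorrectionTerm σ j (Q j))
    (j : Fin N) : (inversePoly Q j).IsWeightedHomogeneous σ (σ j) := by
  have := WeightedHomogeneousSubmodule.gradedMonoid (R := k) (w := σ)
  induction j using WellFoundedLT.induction with
  | _ j ih =>
    rw [inversePoly]
    refine (isWeightedHomogeneous_X k σ j).neg.sub ?_
    refine IsWeightedHomogeneous.aeval_mem (weightedHomogeneousSubmodule k σ) ?_
      (hQ j).homogeneous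
    rintro (i | i)
    · exact isWeightedHomogeneous_X k σ i
    · by_cases h : i < j
      · simpa [h] using! ih i h
      · simp [h]

theorem inversePoly_eq {k : Type*} [Field k] {Q : Fin N → MvPolynomial (Fin N ⊕ Fin N) k}
    (hQ : ∀ j, IsCorrectionTerm σ j (Q j)) (j : Fin N) :
    inversePoly Q j = -X j - aeval (Sum.elim X (inversePoly Q)) (Q j) := by
  rw [inversePoly]
  congr 1
  refine hom_congr_vars (f₁ := (aeval _ : _ →ₐ[k] MvPolynomial (Fin N) k).toRingHom)
    (f₂ := (aeval _ : _ →ₐ[k] MvPolynomial (Fin N) k).toRingHom) (by ext; simp) ?_ rfl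
  rintro (i | i) hi -
  · simp
  · simp [((hQ j).lower i (.inr hi)).1]

theorem polyOp_polyMap_inversePoly {k B : Type*} [Field k] [CommRing B] [Algebra k B]
    {Q : Fin N → MvPolynomial (Fin N ⊕ Fin N) k} (hQ : ∀ j, IsCorrectionTerm σ j (Q j))
    (x : Fin N → B) : polyOp (correctedSum Q) x (polyMap (inversePoly Q) x) = 0 := by
  funext j
  have h : polyMap (inversePoly Q) x j =
      -x j - aeval (Sum.elim x (polyMap (inversePoly Q) x)) (Q j) := by
    conv_lhs => rw [polyMap, inversePoly_eq hQ j]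
    rw [map_sub, map_neg, aeval_X]
    congr 1
    have : ((aeval x).comp (aeval (Sum.elim X (inversePoly Q))) :
        MvPolynomial (Fin N ⊕ Fin N) k →ₐ[k] B) =
        aeval (Sum.elim x (polyMap (inversePoly Q) x)) := by
      refine algHom_ext ?_
      rintro (i | i) <;> simp [polyMap]
    exact congrArg (fun φ => φ (Q j)) this
  rw [polyOp_correctedSum, h, Pi.zero_apply]
  ring

end CorrectionTerms

/-! ### The group law of a homogeneous Lie group -/

section HomogeneousLieGroup

open MvPolynomial

variable {N : ℕ} {σ : Fin N → ℕ} [Group (EuclideanSpace ℝ (Fin N))]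

/-- Scaling by `2` preserves products, so it fixes the unit, but it multiplies each coordinate by `2
^ σ j > 1`. -/
theorem IsHomogeneousLieGroup.one_eq_zero (hG : IsHomogeneousLieGroup σ) :
    (1 : EuclideanSpace ℝ (Fin N)) = 0 := by
  have h := hG.scaling_mul 2 two_ne_zero 1 1
  rw [_root_.mul_one, left_eq_mul] at h
  ext j
  have hj : (2 : ℝ) ^ σ j * (1 : EuclideanSpace ℝ (Fin N)) j =
      (1 : EuclideanSpace ℝ (Fin N)) j := congrArg (fun v => v j) h
  have h2 : (1 : ℝ) < 2 ^ σ j :=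
    one_lt_pow₀ one_lt_two (Nat.one_le_iff_ne_zero.1 (hG.one_le j))
  have h3 : ((2 : ℝ) ^ σ j - 1) * (1 : EuclideanSpace ℝ (Fin N)) j = 0 := by linarith
  rcases mul_eq_zero.1 h3 with h4 | h4
  · linarith
  · simpa using h4

/-- The group law of a homogeneous Lie group is given by weighted homogeneous polynomials. -/
theorem IsHomogeneousLieGroup.exists_polynomial (hG : IsHomogeneousLieGroup σ) (j : Fin N) :
    ∃ p : MvPolynomial (Fin N ⊕ Fin N) ℝ, p.IsWeightedHomogeneous (Sum.elim σ σ) (σ j) ∧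
      ∀ x y : EuclideanSpace ℝ (Fin N), (x * y) j = eval (Sum.elim x y) p := by
  have := hG.lieGroup
  let f : (Fin N ⊕ Fin N → ℝ) → ℝ := fun z =>
    ((WithLp.toLp 2 fun i => z (Sum.inl i) : EuclideanSpace ℝ (Fin N)) *
      (WithLp.toLp 2 fun i => z (Sum.inr i))) j
  have hsmooth : ContDiff ℝ ∞ f := by
    have h1 : ContDiff ℝ ∞ fun z : Fin N ⊕ Fin N → ℝ =>
        (WithLp.toLp 2 fun i => z (Sum.inl i) : EuclideanSpace ℝ (Fin N)) :=
      contDiff_euclidean.2 fun i => contDiff_apply ℝ ℝ (Sum.inl i)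
    have h2 : ContDiff ℝ ∞ fun z : Fin N ⊕ Fin N → ℝ =>
        (WithLp.toLp 2 fun i => z (Sum.inr i) : EuclideanSpace ℝ (Fin N)) :=
      contDiff_euclidean.2 fun i => contDiff_apply ℝ ℝ (Sum.inr i)
    exact contDiff_euclidean.1 (h1.contMDiff.mul (I := 𝓡 N) h2.contMDiff).contDiff j
  have hw : ∀ i, Sum.elim σ σ i ≠ 0 := by
    rintro (i | i) <;> exact Nat.one_le_iff_ne_zero.1 (hG.one_le i)
  obtain ⟨p, hp, hfp⟩ := exists_polynomial_of_homogeneous hw (σ j) hsmooth fun t ht z => by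
    have h := hG.scaling_mul t ht (WithLp.toLp 2 fun i => z (Sum.inl i))
      (WithLp.toLp 2 fun i => z (Sum.inr i))
    have hj := congrArg (fun v : EuclideanSpace ℝ (Fin N) => v j) h
    simpa [f, scaling] using hj.symm
  exact ⟨p, hp, fun x y => hfp (Sum.elim x y)⟩

/-- The group law of a homogeneous Lie group is the sum of vectors up to real correction terms. -/
theorem IsHomogeneousLieGroup.exists_isCorrectionTerm (hG : IsHomogeneousLieGroup σ) :
    ∃ Q : Fin N → MvPolynomial (Fin N ⊕ Fin N) ℝ, (∀ j, IsCorrectionTerm σ j (Q j)) ∧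
      ∀ (x y : EuclideanSpace ℝ (Fin N)) (j : Fin N),
        (x * y) j = x j + y j + eval (Sum.elim x y) (Q j) := by
  choose p hp hmul using hG.exists_polynomial
  have hQ : ∀ (x y : EuclideanSpace ℝ (Fin N)) (j : Fin N),
      eval (Sum.elim x y) (p j - X (Sum.inl j) - X (Sum.inr j)) = (x * y) j - x j - y j :=
    fun x y j => by simp [hmul]
  refine ⟨fun j => p j - X (Sum.inl j) - X (Sum.inr j), fun j => ?_, fun x y j => ?_⟩
  · refine .of_homogeneous_of_mixed hG.one_le hG.monotone
      (((hp j).sub (isWeightedHomogeneous_X ℝ (Sum.elim σ σ) (Sum.inl j))).sub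
        (isWeightedHomogeneous_X ℝ (Sum.elim σ σ) (Sum.inr j))) fun d hd => ⟨?_, ?_⟩
    · obtain ⟨_, ⟨i, rfl⟩, hi⟩ := exists_mem_ne_zero_of_eval_eq_zero (Set.range Sum.inl)
        (fun z hz => by
          have h := hQ 0 (WithLp.toLp 2 fun i => z (Sum.inr i)) j
          rw [← hG.one_eq_zero, _root_.one_mul, hG.one_eq_zero] at h
          have hz' : z = Sum.elim (0 : EuclideanSpace ℝ (Fin N))
              (WithLp.toLp 2 fun i => z (Sum.inr i) : EuclideanSpace ℝ (Fin N)) := by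
            ext (i | i)
            · simpa using hz _ ⟨i, rfl⟩
            · rfl
          rw [hz', h]
          simp) hd
      exact ⟨i, hi⟩
    · obtain ⟨_, ⟨i, rfl⟩, hi⟩ := exists_mem_ne_zero_of_eval_eq_zero (Set.range Sum.inr)
        (fun z hz => by
          have h := hQ (WithLp.toLp 2 fun i => z (Sum.inl i)) 0 j
          rw [← hG.one_eq_zero, _root_.mul_one, hG.one_eq_zero] at h
          have hz' : z = Sum.elim
              (WithLp.toLp 2 fun i => z (Sum.inl i) : EuclideanSpace ℝ (Fin N))
              (0 : EuclideanSpace ℝ (Fin N)) := by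
            ext (i | i)
            · rfl
            · simpa using hz _ ⟨i, rfl⟩
          rw [hz', h]
          simp) hd
      exact ⟨i, hi⟩
  · rw [hQ]
    ring

end HomogeneousLieGroup

/-! ### Descent to the field of coefficients -/

section CoefficientField

open MvPolynomial

/-- Finitely many real polynomials are defined over the field generated by their coefficients. -/
theorem exists_ratAdjoin_coeffs {J τ : Type*} [Fintype J] (Q : J → MvPolynomial τ ℝ) :
    ∃ (n : ℕ) (α : Fin n → ℝ) (q : J → MvPolynomial τ (ratAdjoin α)),
      (∀ j, map (algebraMap (ratAdjoin α) ℝ) (q j) = Q j) ∧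
      ∀ i, ∃ (j : J) (d : τ →₀ ℕ), α i = algebraMap (ratAdjoin α) ℝ ((q j).coeff d) := by
  classical
  let T : Finset ℝ := Finset.univ.biUnion fun j => (Q j).coeffs
  let α : Fin T.card → ℝ := fun i => T.equivFin.symm i
  have hα : ∀ c ∈ T, c ∈ Set.range α := fun c hc => ⟨T.equivFin ⟨c, hc⟩, by simp [α]⟩
  have hq : ∀ j, Q j ∈ (map (σ := τ) (algebraMap (ratAdjoin α) ℝ)).range := fun j => by
    refine mem_range_map_iff_coeffs_subset.2 fun c hc => ?_
    exact ⟨⟨c, IntermediateField.subset_adjoin ℚ _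
      (hα c (Finset.mem_biUnion.2 ⟨j, Finset.mem_univ j, hc⟩))⟩, rfl⟩
  choose q hq using hq
  refine ⟨T.card, α, q, hq, fun i => ?_⟩
  obtain ⟨j, -, hj⟩ := Finset.mem_biUnion.1 (T.equivFin.symm i).2
  obtain ⟨d, -, hd⟩ := mem_coeffs_iff.1 hj
  refine ⟨j, d, ?_⟩
  rw [← coeff_map, hq j]
  exact hd

end CoefficientField

section Construction

open MvPolynomial

/-- Packages the Hopf algebra so that later arguments use only its structure maps on the generators.
-/
theorem IsPolyGroupLaw.exists_hopfAlgebra {J k : Type} [Field k]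
    {P : J → MvPolynomial (J ⊕ J) k} {S : J → MvPolynomial J k}
    (h : IsPolyGroupLaw.{0, 0, 0} P S) :
    ∃ (A : Type) (_ : CommRing A) (_ : HopfAlgebra k A) (e : MvPolynomial J k ≃ₐ[k] A),
      (∀ j, Coalgebra.comul (R := k) (e (X j)) =
        polyOp P (fun i => e (X i) ⊗ₜ 1) (fun i => 1 ⊗ₜ e (X i)) j) ∧
      (∀ j, Coalgebra.counit (R := k) (e (X j)) = 0) ∧
      ∀ j, HopfAlgebra.antipode k (e (X j)) = e (S j) :=
  ⟨MvPolynomial J k, inferInstance, h.hopfAlgebra, AlgEquiv.refl,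
    fun j => aeval_X (polyOp P (fun i => (X i : MvPolynomial J k) ⊗ₜ[k] (1 : MvPolynomial J k))
      (fun i => (1 : MvPolynomial J k) ⊗ₜ[k] (X i : MvPolynomial J k))) j,
    fun j => aeval_X (0 : J → k) j, fun j => aeval_X S j⟩

end Construction

end

theorem mainTheorem5 (N : ℕ) (σ : Fin N → ℕ) [Group (EuclideanSpace ℝ (Fin N))]
    (hG : IsHomogeneousLieGroup σ) :
    -- the field `k = ℚ(α_1, …, α_n)` and the correction terms `Q_j` of the group law over `k`
    ∃ (n : ℕ) (α : Fin n → ℝ)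
      (Q : Fin N → MvPolynomial (Fin N ⊕ Fin N) (ratAdjoin α)),
      (∀ j, IsCorrectionTerm σ j (Q j)) ∧
      (∀ (x y : EuclideanSpace ℝ (Fin N)) (j : Fin N), (x * y) j = x j + y j +
        MvPolynomial.aeval (Sum.elim (fun i => x i) (fun i => y i)) (Q j)) ∧
      -- the adjoined numbers are coefficients of the group law
      (∀ i, ∃ (j : Fin N) (d : (Fin N ⊕ Fin N) →₀ ℕ), α i = algebraMap (ratAdjoin α) ℝ ((Q j).coeff d)) ∧
      -- the Hopf algebra `A = k[X_1, …, X_N]`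
      ∃ (A : Type) (_ : CommRing A)
        (_ : HopfAlgebra (ratAdjoin α) A)
        (e : MvPolynomial (Fin N) (ratAdjoin α)
          ≃ₐ[ratAdjoin α] A),
        (∀ j, Coalgebra.comul (R := ratAdjoin α)
            (e (MvPolynomial.X j)) =
          e (MvPolynomial.X j) ⊗ₜ 1 + 1 ⊗ₜ e (MvPolynomial.X j) +
            MvPolynomial.aeval (Sum.elim (fun i => e (MvPolynomial.X i) ⊗ₜ 1)
              (fun i => 1 ⊗ₜ e (MvPolynomial.X i))) (Q j)) ∧
        IsGradedConnectedHopfAlgebra (ratAdjoin α) A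
          (fun m => (MvPolynomial.weightedHomogeneousSubmodule
            (ratAdjoin α) σ m).map e.toLinearMap) ∧
        -- the group of real points of the group scheme `Spec A` over `k` is the given group
        (∃ Φ : ((Spec (.of ℝ)).asOver
                (Spec (.of (ratAdjoin α))) ⟶
              (Spec (.of A)).asOver
                (Spec (.of (ratAdjoin α)))) ≃*
              EuclideanSpace ℝ (Fin N),
          ∀ (f : A →ₐ[ratAdjoin α] ℝ) (j : Fin N),
            Φ (Spec.mapMulEquiv (WithConv.toConv f)) j = f (e (MvPolynomial.X j))) ∧
        Smooth (Spec (.of A) ↘ Spec (.of (ratAdjoin α))) ∧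
        IsUnipotentGroupScheme.{0, 0, u} (ratAdjoin α) A := by
  obtain ⟨Q, hQ, hmul⟩ := hG.exists_isCorrectionTerm
  obtain ⟨n, α, q, hq, hα⟩ := exists_ratAdjoin_coeffs Q
  have hqc : ∀ j, IsCorrectionTerm σ j (q j) := fun j =>
    .of_map (algebraMap (ratAdjoin α) ℝ) (by rw [hq j]; exact hQ j)
  have hlaw : ∀ (x y : EuclideanSpace ℝ (Fin N)) (j : Fin N), (x * y) j = x j + y j +
      MvPolynomial.aeval (Sum.elim (fun i => x i) (fun i => y i)) (q j) := fun x y j => by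
    rw [hmul, ← hq j, MvPolynomial.eval_map, MvPolynomial.aeval_def]
  let c : EuclideanSpace ℝ (Fin N) ≃ (Fin N → ℝ) := WithLp.equiv 2 (Fin N → ℝ)
  have hc : ∀ x y, c (x * y) = polyOp (correctedSum q) (c x) (c y) := fun x y =>
    funext fun j => (hlaw x y j).trans (polyOp_correctedSum q (c x) (c y) j).symm
  have hc1 : c 1 = 0 := by rw [hG.one_eq_zero]; rfl
  have hinv : ∀ x : Fin N → ℝ,
      polyOp (correctedSum q) x (polyMap (inversePoly q) x) = 0 :=
    polyOp_polyMap_inversePoly hqc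
  have hgroup : IsPolyGroupLaw.{0, 0, 0} (correctedSum q) (inversePoly q) := by
    refine .of_points ℝ (fun x y z => ?_) (fun x => ?_) (fun x => ?_) (fun x => ?_) hinv
    · obtain ⟨x, rfl⟩ := c.surjective x
      obtain ⟨y, rfl⟩ := c.surjective y
      obtain ⟨z, rfl⟩ := c.surjective z
      simp only [← hc, _root_.mul_assoc]
    · obtain ⟨x, rfl⟩ := c.surjective x
      rw [← hc1, ← hc, _root_.one_mul]
    · obtain ⟨x, rfl⟩ := c.surjective x
      rw [← hc1, ← hc, _root_.mul_one]
    -- The recursion yields only a right inverse; at real points it is also a left inverse because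
    -- these form a group.
    · have h := hinv x
      obtain ⟨x, rfl⟩ := c.surjective x
      obtain ⟨y, hy⟩ := c.surjective (polyMap (inversePoly q) (c x))
      rw [← hy, ← hc, ← hc1] at h ⊢
      rw [mul_eq_one_comm.1 (c.injective h)]
  obtain ⟨A, _, _, e, hcomul, hcounit, hanti⟩ := hgroup.exists_hopfAlgebra
  have hgraded : IsGradedConnectedHopfAlgebra (ratAdjoin α) A
      (fun m => (MvPolynomial.weightedHomogeneousSubmodule
        (ratAdjoin α) σ m).map e.toLinearMap) := by
    refine isGradedConnectedHopfAlgebra_of_generators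
      (fun j => Nat.one_le_iff_ne_zero.1 (hG.one_le j)) e (fun j => ?_) hcounit fun j => ?_
    · rw [hcomul]
      exact aeval_mem_tensorGrading σ e (isWeightedHomogeneous_correctedSum hqc j)
    · rw [hanti]
      exact ⟨inversePoly q j, isWeightedHomogeneous_inversePoly hqc j, rfl⟩
  refine ⟨n, α, q, hqc, hlaw, hα, A, inferInstance, inferInstance, e, fun j => ?_, hgraded,
    exists_points_mulEquiv c hc e hcomul, smooth_Spec_of_algEquiv e,
    hgraded.isUnipotentGroupScheme⟩
  rw [hcomul, polyOp_correctedSum]
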